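/- For a metric space $(X,d_X)$, let $\mathrm{Cone}(X)$ (the Euclidean cone over $X$) be the completion of $(0,\infty)\times X$ under the metric $$d_{\mathrm{Cone}(X)}\big((s,x),(t,y)\big)=\sqrt{s^2+t^2-2st\cos(\min\{\pi,d_X(x,y)\})}.$$ Let $L_1=L_1([0,1])$ be the space of real integrable functions on $[0,1]$ with Lebesgue measure, with norm $\|\cdot\|_1$. A metric space $U$ embeds into $L_1$ with distortion at most $D\in[1,\infty)$ if there are $\sigma>0$ and $f:U\to L_1$ with $\sigma d_U(x,y)\le\|f(x)-f(y)\|_1\le D\sigma d_U(x,y)$ for all $x,y\in U$; $c_1(U)$ is the infimum of all such $D$ (and $c_1(U)=\infty$ if there are none). Put $$K=\frac{\sqrt{20\pi^2e^2+5(e-1)^2}}{2(e-1)}.$$ 1. There is a mapping $T:L_1\to L_1$ such that $\|T(x)\|_1=\pi$ for every $x\in L_1$ and, for all $x,y\in L_1$, $$\Big(1-\frac1e\Big)\min\{\pi,\|x-y\|_1\}\le\|T(x)-T(y)\|_1\le\min\{\pi,\|x-y\|_1\}.\qquad(*)$$ 2. For every $T:L_1\to L_1$ satisfying $\|T(x)\|_1=\pi$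 for all $x\in L_1$ and $(*)$, there is $F:\mathrm{Cone}(L_1)\to L_1$ with $F(s,x)=s\,T(x)$ for all $(s,x)\in(0,\infty)\times L_1$ and, for all $p,q\in\mathrm{Cone}(L_1)$, $$\frac{\pi(e-1)}{\sqrt{4\pi^2e^2+(e-1)^2}}\,d_{\mathrm{Cone}(L_1)}(p,q)\le\|F(p)-F(q)\|_1\le\frac{\pi\sqrt5}{2}\,d_{\mathrm{Cone}(L_1)}(p,q).$$ 3. Consequently $\mathrm{Cone}(L_1)$ admits a bi-Lipschitz embedding into $L_1$ with distortion at most $K$, and $c_1(\mathrm{Cone}(L_1))\le K\le 11.17$. 4. Every metric space $X$ satisfies $c_1(\mathrm{Cone}(X))\le K\,c_1(X)$; in particular $c_1(\mathrm{Cone}(X))\lesssim c_1(X)$. -/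

import Mathlib

open scoped ENNReal

/-- Points `(s, x)` of `(0, ∞) × X`. -/
@[ext]
structure OpenCone (X : Type*) where
  radius : ℝ
  radius_pos : 0 < radius
  base : X

/-- The length of the third side of a planar triangle with two sides `s`, `t` at angle `θ`. -/
noncomputable def planarDist (s t θ : ℝ) : ℝ :=
  Real.sqrt (s ^ 2 + t ^ 2 - 2 * s * t * Real.cos θ)

/-- The Euclidean cone distance on `(0, ∞) × X`. -/
noncomputable def coneDist {X : Type*} [MetricSpace X] (p q : OpenCone X) : ℝ :=
  planarDist p.radius q.radius (min Real.pi (dist p.base q.base))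

theorem planarDist_eq_norm (s t a b : ℝ) :
    planarDist s t (b - a) =
      ‖(s : ℂ) * Complex.exp (a * Complex.I) - t * Complex.exp (b * Complex.I)‖ := by
  rw [planarDist, Complex.norm_eq_sqrt_sq_add_sq]
  congr 1
  simp only [Complex.exp_mul_I, ← Complex.ofReal_cos, ← Complex.ofReal_sin, Complex.sub_re,
    Complex.sub_im, Complex.mul_re, Complex.mul_im, Complex.add_re, Complex.add_im,
    Complex.ofReal_re, Complex.ofReal_im, Complex.I_re, Complex.I_im, Real.cos_sub]
  linear_combination (-s ^ 2) * Real.sin_sq_add_cos_sq a - t ^ 2 * Real.sin_sq_add_cos_sq b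

theorem planarDist_triangle (r s t α β : ℝ) :
    planarDist r t (α + β) ≤ planarDist r s α + planarDist s t β := by
  have h₁ := planarDist_eq_norm r t 0 (α + β)
  have h₂ := planarDist_eq_norm r s 0 α
  have h₃ := planarDist_eq_norm s t α (α + β)
  rw [sub_zero] at h₁ h₂
  rw [add_sub_cancel_left] at h₃
  rw [h₁, h₂, h₃]
  exact norm_sub_le_norm_sub_add_norm_sub _ _ _

theorem planarDist_mono {s t α β : ℝ} (hs : 0 ≤ s) (ht : 0 ≤ t) (hα : 0 ≤ α) (hαβ : α ≤ β)
    (hβ : β ≤ Real.pi) : planarDist s t α ≤ planarDist s t β := by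
  have hcos := Real.cos_le_cos_of_nonneg_of_le_pi hα hβ hαβ
  have hst : 0 ≤ 2 * s * t := by positivity
  exact Real.sqrt_le_sqrt (by nlinarith [mul_le_mul_of_nonneg_left hcos hst])

theorem coneDist_triangle {X : Type*} [MetricSpace X] (p q r : OpenCone X) :
    coneDist p r ≤ coneDist p q + coneDist q r := by
  have hpi := Real.pi_pos
  have hp := p.radius_pos
  have hq := q.radius_pos
  have hr := r.radius_pos
  have hpq : 0 ≤ dist p.base q.base := dist_nonneg
  have hqr : 0 ≤ dist q.base r.base := dist_nonneg
  have hpr : 0 ≤ dist p.base r.base := dist_nonneg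
  have htri := dist_triangle p.base q.base r.base
  unfold coneDist
  set α := min Real.pi (dist p.base q.base) with hα
  set β := min Real.pi (dist q.base r.base) with hβ
  set γ := min Real.pi (dist p.base r.base) with hγ
  have h₁ : planarDist p.radius r.radius γ ≤
      planarDist p.radius r.radius (α + min β (Real.pi - α)) := by
    apply planarDist_mono hp.le hr.le <;> grind
  have h₂ : planarDist q.radius r.radius (min β (Real.pi - α)) ≤
      planarDist q.radius r.radius β := by
    apply planarDist_mono hq.le hr.le <;> grind
  linarith [planarDist_triangle p.radius q.radius r.radius α (min β (Real.pi - α))]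

noncomputable instance OpenCone.instMetricSpace {X : Type*} [MetricSpace X] :
    MetricSpace (OpenCone X) where
  dist := coneDist
  dist_self p := by
    simp only [coneDist, planarDist, dist_self, min_eq_right Real.pi_pos.le, Real.cos_zero]
    rw [show p.radius ^ 2 + p.radius ^ 2 - 2 * p.radius * p.radius * 1 = 0 by ring,
      Real.sqrt_zero]
  dist_comm p q := by
    simp only [coneDist, planarDist, dist_comm q.base p.base]
    congr 1
    ring
  dist_triangle := coneDist_triangle
  eq_of_dist_eq_zero := by
    intro p q h
    change coneDist p q = 0 at h
    have hp := p.radius_pos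
    have hq := q.radius_pos
    have hpq : 0 < p.radius * q.radius := mul_pos hp hq
    have hd : 0 ≤ dist p.base q.base := dist_nonneg
    have hpi := Real.pi_pos
    unfold coneDist planarDist at h
    set θ := min Real.pi (dist p.base q.base) with hθ
    have hcos := Real.cos_le_one θ
    have hθ₀ : 0 ≤ θ := le_min hpi.le hd
    have hθ₁ : θ ≤ Real.pi := min_le_left _ _
    have hprod : 0 ≤ p.radius * q.radius * (1 - Real.cos θ) :=
      mul_nonneg hpq.le (by linarith)
    rw [Real.sqrt_eq_zero (by nlinarith [sq_nonneg (p.radius - q.radius)])] at h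
    have hrad : p.radius - q.radius = 0 := by
      apply pow_eq_zero_iff (two_ne_zero) |>.mp
      nlinarith [sq_nonneg (p.radius - q.radius)]
    have hone : p.radius * q.radius * (1 - Real.cos θ) = 0 := by
      nlinarith [sq_nonneg (p.radius - q.radius)]
    have hcos₁ : Real.cos θ = 1 := by
      rcases mul_eq_zero.mp hone with h0 | h0 <;> linarith
    have hθ₂ : θ = 0 :=
      (Real.cos_eq_one_iff_of_lt_of_lt (by linarith) (by linarith)).mp hcos₁
    have hbase : dist p.base q.base = 0 := by grind
    exact OpenCone.ext (sub_eq_zero.mp hrad) (dist_eq_zero.mp hbase)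

/-- The Euclidean cone over `X`: the metric completion of `(0, ∞) × X`. -/
abbrev EuclideanCone (X : Type*) [MetricSpace X] : Type _ :=
  UniformSpace.Completion (OpenCone X)

/-- The point `(s, x)`, `s > 0`, of the Euclidean cone. -/
noncomputable def EuclideanCone.mk {X : Type*} [MetricSpace X] (s : ℝ) (hs : 0 < s) (x : X) :
    EuclideanCone X :=
  ((⟨s, hs, x⟩ : OpenCone X) : UniformSpace.Completion (OpenCone X))

/-- The Banach space of (classes of) Lebesgue integrable real functions on `[0, 1]`. -/
abbrev L1 : Type :=
  MeasureTheory.Lp ℝ 1 (MeasureTheory.volume : MeasureTheory.Measure unitInterval)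

/-- `U` admits a bi-Lipschitz embedding into `V` with distortion at most `D ∈ [1, ∞)`. -/
def AdmitsBiLipEmbedding (U V : Type*) [MetricSpace U] [MetricSpace V] (D : ℝ) : Prop :=
  1 ≤ D ∧ ∃ s : ℝ, 0 < s ∧ ∃ f : U → V, ∀ x y : U,
    s * dist x y ≤ dist (f x) (f y) ∧ dist (f x) (f y) ≤ D * s * dist x y

/-- The `L₁` distortion of `U` (equal to `∞` if `U` has no bi-Lipschitz embedding into `L₁`). -/
noncomputable def c₁ (U : Type*) [MetricSpace U] : ℝ≥0∞ :=
  ⨅ (D : ℝ) (_ : AdmitsBiLipEmbedding U L1 D), ENNReal.ofReal D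

/-- `T` maps `L₁` into the sphere of radius `M` of `L₁`, and it is an embedding of `L₁` with the
truncated metric `min {M, ‖x - y‖₁}` into `L₁`, with constants `1 - 1/e` and `1`. -/
def IsTruncatedEmbedding (M : ℝ) (T : L1 → L1) : Prop :=
  (∀ x, ‖T x‖ = M) ∧ ∀ x y,
    (1 - 1 / Real.exp 1) * min M ‖x - y‖ ≤ ‖T x - T y‖ ∧ ‖T x - T y‖ ≤ min M ‖x - y‖

/-- The explicit distortion bound
`√(20 π² e² + 5 (e - 1)²) / (2 (e - 1))`. -/
noncomputable def coneDistortion : ℝ :=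
  Real.sqrt (20 * Real.pi ^ 2 * Real.exp 1 ^ 2 + 5 * (Real.exp 1 - 1) ^ 2) /
    (2 * (Real.exp 1 - 1))

/-! Throw a Poisson process of intensity `1 / (2M)` on the strip `[0, 1] × ℝ` and send `g` to `M`
times the parity sign of the number of points between its graph and the axis. The product of two
such signs is the parity of a Poisson number of mean `‖g - h‖₁ / (2M)`, so its expectation is `exp
(-‖g - h‖₁ / M)` and the `L₁` distance of the images is `M (1 - exp (-‖g - h‖₁ / M))`. This is
comparable to the truncated metric with constants `1 - 1/e` and `1`. The sample space is replaced by
`[0, 1]`, and density of continuous functions gives all of `L₁` (`exists_exponential_embedding`).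

With `M = π`, the radial extension `(s, x) ↦ s • T x` is bi-Lipschitz: the squared cone distance is
`(s - t)² + 4 s t sin² (θ / 2)`, and its radial and angular terms are each compared with `‖s • T x -
t • T y‖`. For general `X`, coning a map `X → L₁` of distortion `D` costs at most `D`, because `sin
(c θ) ≤ c sin θ`. -/

/-! ### Products over independent and Poisson samples -/

open MeasureTheory ProbabilityTheory in
theorem integral_prod_eval_infinitePi {ι S : Type*} [MeasurableSpace S] (μ : ι → Measure S)
    [∀ i, IsProbabilityMeasure (μ i)] (s : Finset ι) (f : ι → S → ℝ)
    (hf : ∀ i, Measurable (f i)) :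
    ∫ ω, ∏ i ∈ s, f i (ω i) ∂(Measure.infinitePi μ) = ∏ i ∈ s, ∫ z, f i z ∂(μ i) := by
  have h := ((iIndepFun_infinitePi (P := μ) hf).precomp
    (Subtype.val_injective (p := (· ∈ s)))).integral_fun_prod_eq_prod_integral
      (fun i => ((hf i).comp (measurable_pi_apply _)).aestronglyMeasurable)
  simp only [← Finset.prod_coe_sort s]
  refine h.trans (Finset.prod_congr rfl fun i _ => ?_)
  have := measurePreserving_eval_infinitePi μ (i : ι)
  rw [← this.map_eq, integral_map this.measurable.aemeasurable (hf i).aestronglyMeasurable]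

open MeasureTheory ProbabilityTheory in
theorem integral_pow_poissonMeasure (r : NNReal) (a : ℝ) :
    ∫ n, a ^ n ∂(poissonMeasure r) = Real.exp (r * (a - 1)) := by
  rw [integral_poissonMeasure]
  have h := (NormedSpace.expSeries_div_hasSum_exp (r * a : ℝ)).mul_left (Real.exp (-r))
  rw [← Real.exp_eq_exp_ℝ, ← Real.exp_add] at h
  rw [show (r : ℝ) * (a - 1) = -r + r * a by ring, ← h.tsum_eq]
  refine tsum_congr fun n => ?_
  rw [smul_eq_mul, mul_pow]
  ring

/-- The law of a Poisson number of independent samples from `μ`. -/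
noncomputable abbrev poissonSampleMeasure {S : Type*} [MeasurableSpace S]
    (μ : MeasureTheory.Measure S) (r : NNReal) : MeasureTheory.Measure (ℕ × (ℕ → S)) :=
  (ProbabilityTheory.poissonMeasure r).prod (MeasureTheory.Measure.infinitePi fun _ : ℕ => μ)

theorem measurable_prod_range_sample {S : Type*} [MeasurableSpace S] {f : S → ℝ}
    (hf : Measurable f) : Measurable fun ω : ℕ × (ℕ → S) => ∏ i ∈ Finset.range ω.1, f (ω.2 i) := by
  refine measurable_from_prod_countable_right fun n => ?_
  exact Finset.measurable_fun_prod (Finset.range n) fun i _ => hf.comp (measurable_pi_apply i)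

-- Conditionally on the number `n` of samples, independence gives `(∫ f) ^ n`; the generating
-- function of the Poisson law then sums over `n`.
open MeasureTheory ProbabilityTheory in
theorem integral_prod_range_poissonSampleMeasure {S : Type*} [MeasurableSpace S]
    (μ : Measure S) [IsProbabilityMeasure μ] (r : NNReal) {f : S → ℝ} (hf : Measurable f)
    (hf1 : ∀ z, |f z| ≤ 1) :
    ∫ ω, ∏ i ∈ Finset.range ω.1, f (ω.2 i) ∂(poissonSampleMeasure μ r) =
      Real.exp (r * (∫ z, f z ∂μ - 1)) := by
  have hint : Integrable (fun ω : ℕ × (ℕ → S) => ∏ i ∈ Finset.range ω.1, f (ω.2 i))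
      (poissonSampleMeasure μ r) := by
    refine Integrable.of_bound (measurable_prod_range_sample hf).aestronglyMeasurable 1
      (ae_of_all _ fun ω => ?_)
    rw [Real.norm_eq_abs, Finset.abs_prod]
    exact Finset.prod_le_one (fun _ _ => abs_nonneg _) fun _ _ => hf1 _
  rw [integral_prod _ hint, ← integral_pow_poissonMeasure]
  refine integral_congr_ae (ae_of_all _ fun n => ?_)
  simpa using integral_prod_eval_infinitePi (fun _ : ℕ => μ) (Finset.range n) (fun _ => f)
    fun _ => hf

/-! ### Signs of levels and the cells of the line -/

/-- `-1` below the level `a` and `1` from `a` on. -/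
noncomputable def levelSign (a u : ℝ) : ℝ := if u < a then -1 else 1

theorem levelSign_mul_self (a u : ℝ) : levelSign a u * levelSign a u = 1 := by
  unfold levelSign; split_ifs <;> norm_num

theorem measurable_levelSign : Measurable fun p : ℝ × ℝ => levelSign p.1 p.2 :=
  Measurable.ite (measurableSet_lt measurable_snd measurable_fst) measurable_const
    measurable_const

theorem levelSign_mul_levelSign (a b u : ℝ) :
    levelSign a u * levelSign b u =
      1 - 2 * (Set.Ico (min a b) (max a b)).indicator (fun _ => (1 : ℝ)) u := by
  unfold levelSign
  by_cases ha : u < a <;> by_cases hb : u < b <;>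
    simp [Set.indicator, ha, hb, not_le.2, not_lt.1] <;> norm_num

theorem integral_indicator_Ico_min_max (a b : ℝ) :
    ∫ u, (Set.Ico (min a b) (max a b)).indicator (fun _ => (1 : ℝ)) u = |a - b| := by
  rw [MeasureTheory.integral_indicator measurableSet_Ico]
  simp [max_sub_min_eq_abs', MeasureTheory.measureReal_def]

-- The integer translates of `[0, 1]` tile the line up to a null set, and those with `k` outside
-- `[-m, m)` contribute nothing.
open MeasureTheory in
theorem sum_integral_indicator_Ico_min_max {m : ℕ} {a b : ℝ} (ha : |a| ≤ m) (hb : |b| ≤ m) :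
    ∑ k ∈ Finset.Ico (-m : ℤ) m, ∫ v : unitInterval,
      (Set.Ico (min a b) (max a b)).indicator (fun _ => (1 : ℝ)) (v + k) = |a - b| := by
  set f : ℝ → ℝ := (Set.Ico (min a b) (max a b)).indicator (fun _ => (1 : ℝ)) with hf
  have hint : Integrable f := by
    rw [hf, integrable_indicator_iff measurableSet_Ico]
    simp
  have h := hint.hasSum_intervalIntegral_comp_add_int
  rw [integral_indicator_Ico_min_max] at h
  rw [← h.tsum_eq]
  rw [abs_le] at ha hb
  have hcoe (k : ℤ) : ∫ v : unitInterval, f (v + k) = ∫ v in (0 : ℝ)..1, f (v + k) := by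
    rw [intervalIntegral.integral_of_le zero_le_one, ← integral_Icc_eq_integral_Ioc]
    exact integral_subtype_comap measurableSet_Icc fun v : ℝ => f (v + k)
  simp only [hcoe]
  refine (tsum_eq_sum fun k hk => ?_).symm
  rw [intervalIntegral.integral_of_le zero_le_one, ← integral_Ico_eq_integral_Ioc]
  refine setIntegral_eq_zero_of_forall_eq_zero fun v hv => ?_
  refine Set.indicator_of_notMem (fun hmem => hk ?_) _
  simp only [Set.mem_Ico, min_le_iff, lt_max_iff, Finset.mem_Ico] at hmem hv ⊢
  constructor
  · have : (-(m : ℝ)) < k + 1 := by rcases hmem.1 with h | h <;> linarith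
    have : -(m : ℤ) < k + 1 := by exact_mod_cast this
    omega
  · have : (k : ℝ) < m := by rcases hmem.2 with h | h <;> linarith
    exact_mod_cast this

/-! ### Parities of a Poisson process under a graph -/

/-- The configurations of points in the strip `[0, 1] × ℝ`: the points at height in `[k, k + 1]`
are the first `(ω k).1` terms of the sequence `(ω k).2`, shifted by `k`. -/
abbrev StripConfiguration : Type := ℤ → ℕ × (ℕ → unitInterval × unitInterval)

/-- The law of the Poisson process of intensity `r` on `[0, 1] × ℝ`. -/
noncomputable abbrev stripPoissonMeasure (r : NNReal) : MeasureTheory.Measure StripConfiguration :=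
  MeasureTheory.Measure.infinitePi fun _ : ℤ => poissonSampleMeasure MeasureTheory.volume r

/-- The sign recording whether a point of the `k`-th cell separates the graph of `g`
from the horizontal axis. -/
noncomputable def cellSign (g : unitInterval → ℝ) (k : ℤ) (z : unitInterval × unitInterval) : ℝ :=
  levelSign (g z.1) (z.2 + k) * levelSign 0 (z.2 + k)

/-- The parity of the number of points between the graph of `g` and the horizontal axis. -/
noncomputable def graphParity (g : unitInterval → ℝ) (ω : StripConfiguration) : ℝ :=
  ∏ᶠ k : ℤ, ∏ i ∈ Finset.range (ω k).1, cellSign g k ((ω k).2 i)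

theorem cellSign_mul_self (g : unitInterval → ℝ) (k : ℤ) (z : unitInterval × unitInterval) :
    cellSign g k z * cellSign g k z = 1 := by
  rw [cellSign, mul_mul_mul_comm, levelSign_mul_self, levelSign_mul_self, one_mul]

theorem cellSign_mul_cellSign (g h : unitInterval → ℝ) (k : ℤ) (z : unitInterval × unitInterval) :
    cellSign g k z * cellSign h k z =
      levelSign (g z.1) (z.2 + k) * levelSign (h z.1) (z.2 + k) := by
  rw [cellSign, cellSign, mul_mul_mul_comm, levelSign_mul_self, mul_one]

theorem measurable_cellSign {g : unitInterval → ℝ} (hg : Measurable g) (k : ℤ) :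
    Measurable (cellSign g k) := by
  refine Measurable.mul ?_ ?_
  · exact measurable_levelSign.comp (f := fun z : unitInterval × unitInterval =>
      (g z.1, (z.2 + k : ℝ))) (by fun_prop)
  · exact measurable_levelSign.comp (f := fun z : unitInterval × unitInterval =>
      ((0 : ℝ), (z.2 + k : ℝ))) (by fun_prop)

/-- Far cells lie on one side of both the graph and the axis. The bound is strict because the cell
ending at height `-m` contains that height. -/
theorem cellSign_eq_one {g : unitInterval → ℝ} {m : ℕ} (hg : ∀ t, |g t| < m) {k : ℤ}
    (hk : k ∉ Finset.Ico (-m : ℤ) m) (z : unitInterval × unitInterval) :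
    cellSign g k z = 1 := by
  have hz0 := z.2.2.1
  have hz1 := z.2.2.2
  have hgz := abs_lt.1 (hg z.1)
  rw [Finset.mem_Ico, not_and_or, not_le, not_lt] at hk
  unfold cellSign levelSign
  rcases hk with hk | hk
  · have : (k : ℝ) + 1 ≤ -m := by exact_mod_cast hk
    rw [if_pos (by linarith), if_pos (by linarith)]
    norm_num
  · have : (m : ℝ) ≤ k := by exact_mod_cast hk
    rw [if_neg (by linarith), if_neg (by linarith)]
    norm_num

theorem graphParity_eq_prod {g : unitInterval → ℝ} {m : ℕ} (hg : ∀ t, |g t| < m)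
    (ω : StripConfiguration) :
    graphParity g ω = ∏ k ∈ Finset.Ico (-m : ℤ) m,
      ∏ i ∈ Finset.range (ω k).1, cellSign g k ((ω k).2 i) := by
  refine finprod_eq_prod_of_mulSupport_subset _ fun k hk => ?_
  by_contra hk'
  exact hk (Finset.prod_eq_one fun i _ => cellSign_eq_one hg hk' _)

theorem measurable_graphParity {g : unitInterval → ℝ} {m : ℕ} (hg : ∀ t, |g t| < m)
    (hgm : Measurable g) : Measurable (graphParity g) := by
  rw [funext (graphParity_eq_prod hg)]
  exact Finset.measurable_fun_prod _ fun k _ =>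
    (measurable_prod_range_sample (measurable_cellSign hgm k)).comp (measurable_pi_apply k)

theorem graphParity_mul_self {g : unitInterval → ℝ} {m : ℕ} (hg : ∀ t, |g t| < m)
    (ω : StripConfiguration) : graphParity g ω * graphParity g ω = 1 := by
  simp [graphParity_eq_prod hg, ← Finset.prod_mul_distrib, cellSign_mul_self]

open MeasureTheory in
theorem integral_cellSign_mul_cellSign {g h : unitInterval → ℝ} (hg : Measurable g)
    (hh : Measurable h) (k : ℤ) :
    ∫ z, cellSign g k z * cellSign h k z = 1 - 2 * ∫ t, ∫ v : unitInterval,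
      (Set.Ico (min (g t) (h t)) (max (g t) (h t))).indicator (fun _ => (1 : ℝ)) (v + k) := by
  have hint : Integrable fun z => cellSign g k z * cellSign h k z := by
    refine Integrable.of_bound
      ((measurable_cellSign hg k).mul (measurable_cellSign hh k)).aestronglyMeasurable 1
      (ae_of_all _ fun z => ?_)
    rw [Real.norm_eq_abs]
    refine (sq_le_one_iff_abs_le_one _).1 (le_of_eq ?_)
    rw [sq, mul_mul_mul_comm, cellSign_mul_self, cellSign_mul_self, one_mul]
  set D : unitInterval × unitInterval → ℝ := fun z =>
    (Set.Ico (min (g z.1) (h z.1)) (max (g z.1) (h z.1))).indicator (fun _ => (1 : ℝ))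
      (z.2 + k) with hD
  have hsep (z) : cellSign g k z * cellSign h k z = 1 - 2 * D z := by
    rw [cellSign_mul_cellSign, levelSign_mul_levelSign]
  have hDint : Integrable D := by
    -- Integrability of the region between the graphs is read off from the signs: `D = (1 - product)
    -- / 2`.
    refine (((integrable_const (1 : ℝ)).sub hint).div_const 2).congr (ae_of_all _ fun z => ?_)
    simp only [Pi.sub_apply, hsep]
    ring
  have hfub : ∫ t, ∫ v : unitInterval,
      (Set.Ico (min (g t) (h t)) (max (g t) (h t))).indicator (fun _ => (1 : ℝ)) (v + k) =
        ∫ z, D z := (integral_prod D hDint).symm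
  rw [hfub]
  simp only [hsep]
  rw [integral_sub (integrable_const _) (hDint.const_mul 2), integral_const_mul]
  simp

-- Cells are independent, and cell `k` contributes `exp (-2 r A)` with `A` the area it shares with
-- the region between the graphs. These areas add up to `∫ |g - h|`.
open MeasureTheory in
theorem integral_graphParity_mul {g h : unitInterval → ℝ} {m : ℕ} (hg : ∀ t, |g t| < m)
    (hh : ∀ t, |h t| < m) (hgm : Measurable g) (hhm : Measurable h) (r : NNReal) :
    ∫ ω, graphParity g ω * graphParity h ω ∂(stripPoissonMeasure r) =
      Real.exp (-(2 * r * ∫ t, |g t - h t|)) := by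
  have hmeas (k : ℤ) : Measurable fun z => cellSign g k z * cellSign h k z :=
    (measurable_cellSign hgm k).mul (measurable_cellSign hhm k)
  have hle (k : ℤ) (z) : |cellSign g k z * cellSign h k z| ≤ 1 := by
    refine (sq_le_one_iff_abs_le_one _).1 (le_of_eq ?_)
    rw [sq, mul_mul_mul_comm, cellSign_mul_self, cellSign_mul_self, one_mul]
  simp only [graphParity_eq_prod hg, graphParity_eq_prod hh, ← Finset.prod_mul_distrib]
  rw [integral_prod_eval_infinitePi _ _
    (fun k (ω : ℕ × (ℕ → unitInterval × unitInterval)) =>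
      ∏ i ∈ Finset.range ω.1, (cellSign g k (ω.2 i) * cellSign h k (ω.2 i)))
    fun k => measurable_prod_range_sample (hmeas k)]
  simp only [integral_prod_range_poissonSampleMeasure _ r (hmeas _) (hle _),
    integral_cellSign_mul_cellSign hgm hhm, ← Real.exp_sum, ← Finset.mul_sum]
  congr 1
  simp only [sub_sub_cancel_left, Finset.sum_neg_distrib, ← Finset.mul_sum]
  rw [← integral_finsetSum]
  · simp only [sum_integral_indicator_Ico_min_max (hg _).le (hh _).le]
    ring
  · intro k _
    have hsm : StronglyMeasurable fun z : unitInterval × unitInterval =>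
        (Set.Ico (min (g z.1) (h z.1)) (max (g z.1) (h z.1))).indicator (fun _ => (1 : ℝ))
          (z.2 + k) := by
      refine Measurable.stronglyMeasurable ?_
      have : (fun z : unitInterval × unitInterval =>
          (Set.Ico (min (g z.1) (h z.1)) (max (g z.1) (h z.1))).indicator (fun _ => (1 : ℝ))
            (z.2 + k)) = fun z => (1 - cellSign g k z * cellSign h k z) / 2 := by
        ext z
        rw [cellSign_mul_cellSign, levelSign_mul_levelSign]
        ring
      rw [this]
      exact (measurable_const.sub (hmeas k)).div_const 2
    refine Integrable.of_bound hsm.integral_prod_right.aestronglyMeasurable 1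
      (ae_of_all _ fun t => ?_)
    refine (norm_integral_le_of_norm_le_const (C := 1) (ae_of_all _ fun v => ?_)).trans
      (by simp)
    simp only [Set.indicator]
    split_ifs <;> simp

/-! ### The embedding of the truncated metric -/

instance StripConfiguration.instStandardBorelSpace : StandardBorelSpace StripConfiguration :=
  @StandardBorelSpace.pi_countable ℤ _ (fun _ => ℕ × (ℕ → unitInterval × unitInterval)) _
    fun _ => inferInstance

open MeasureTheory in
theorem norm_toL1_sub_toL1 {f g : unitInterval → ℝ} (hf : Integrable f volume)
    (hg : Integrable g volume) :
    ‖hf.toL1 f - hg.toL1 g‖ = ∫ t, |f t - g t| := by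
  rw [← Integrable.toL1_sub, L1.norm_of_fun_eq_integral_norm]
  rfl

open MeasureTheory in
/-- On the dense subset of continuous functions, random parities realise the kernel
`1 - exp (-‖x - y‖₁ / M)`. -/
theorem exists_exponential_embedding_continuous {M : ℝ} (hM : 0 < M) :
    ∃ T : C(unitInterval, ℝ) → L1, (∀ f, ‖T f‖ = M) ∧ ∀ f g,
      ‖T f - T g‖ = M * (1 - Real.exp (-((∫ t, |f t - g t|) / M))) := by
  -- The Poisson law on a standard Borel space is the image of Lebesgue measure on `[0, 1]`, so
  -- parities become functions on `[0, 1]`. The intensity `1 / (2M)` turns the exponent `2 r` into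
  -- `1 / M`.
  obtain ⟨φ, hφ, hmap⟩ := Measure.exists_measurable_map_eq
    (stripPoissonMeasure (Real.toNNReal (1 / (2 * M))))
  have hbound (f : C(unitInterval, ℝ)) : ∃ m : ℕ, ∀ t, |f t| < m := by
    obtain ⟨m, hm⟩ := exists_nat_gt ‖f‖
    exact ⟨m, fun t => (f.norm_coe_le_norm t).trans_lt hm⟩
  have hmeas (f : C(unitInterval, ℝ)) : Measurable (graphParity f) :=
    let ⟨_, hm⟩ := hbound f
    measurable_graphParity hm f.continuous.measurable
  have hsq (f : C(unitInterval, ℝ)) (ω) : graphParity f ω * graphParity f ω = 1 :=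
    let ⟨_, hm⟩ := hbound f
    graphParity_mul_self hm ω
  have habs (f : C(unitInterval, ℝ)) (ω) : |graphParity f ω| = 1 := by
    rcases mul_self_eq_one_iff.1 (hsq f ω) with h | h <;> simp [h]
  have hint (f : C(unitInterval, ℝ)) : Integrable fun t => M * graphParity f (φ t) := by
    refine Integrable.of_bound (((hmeas f).comp hφ).const_mul M).aestronglyMeasurable M
      (ae_of_all _ fun t => ?_)
    rw [norm_mul, Real.norm_eq_abs, Real.norm_eq_abs, habs, abs_of_pos hM, mul_one]
  refine ⟨fun f => (hint f).toL1 _, fun f => ?_, fun f g => ?_⟩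
  · rw [L1.norm_of_fun_eq_integral_norm]
    simp [habs, abs_of_pos hM]
  · have hprod : ∫ t, graphParity f (φ t) * graphParity g (φ t) =
        Real.exp (-((∫ t, |f t - g t|) / M)) := by
      obtain ⟨m₁, hm₁⟩ := hbound f
      obtain ⟨m₂, hm₂⟩ := hbound g
      have h₁ (t) : |f t| < (max m₁ m₂ : ℕ) := (hm₁ t).trans_le (by simp)
      have h₂ (t) : |g t| < (max m₁ m₂ : ℕ) := (hm₂ t).trans_le (by simp)
      have h := integral_graphParity_mul h₁ h₂ f.continuous.measurable g.continuous.measurable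
        (Real.toNNReal (1 / (2 * M)))
      rw [← hmap] at h
      rw [← integral_map (f := fun ω => graphParity f ω * graphParity g ω) hφ.aemeasurable
        ((hmeas f).mul (hmeas g)).aestronglyMeasurable, h, Real.coe_toNNReal _ (by positivity)]
      congr 2
      field_simp
    have hpint : Integrable fun t => graphParity f (φ t) * graphParity g (φ t) := by
      refine Integrable.of_bound
        (((hmeas f).comp hφ).mul ((hmeas g).comp hφ)).aestronglyMeasurable 1
        (ae_of_all _ fun t => ?_)
      rw [norm_mul, Real.norm_eq_abs, Real.norm_eq_abs, habs, habs, mul_one]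
    rw [norm_toL1_sub_toL1, ← hprod]
    have hpt (t) : |M * graphParity f (φ t) - M * graphParity g (φ t)| =
        M * (1 - graphParity f (φ t) * graphParity g (φ t)) := by
      rw [← mul_sub, abs_mul, abs_of_pos hM]
      congr 1
      rcases mul_self_eq_one_iff.1 (hsq f (φ t)) with h | h <;>
        rcases mul_self_eq_one_iff.1 (hsq g (φ t)) with h' | h' <;> rw [h, h'] <;> norm_num
    simp only [hpt]
    rw [integral_const_mul, integral_sub (integrable_const _) hpint]
    simp

theorem one_sub_exp_neg_le_min (u : ℝ) : 1 - Real.exp (-u) ≤ min 1 u := by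
  have := Real.add_one_le_exp (-u)
  have := Real.exp_pos (-u)
  exact le_min (by linarith) (by linarith)

theorem mul_min_le_one_sub_exp_neg (u : ℝ) (hu : 0 ≤ u) :
    (1 - 1 / Real.exp 1) * min 1 u ≤ 1 - Real.exp (-u) := by
  rw [one_div, ← Real.exp_neg]
  rcases le_total 1 u with h | h
  · rw [min_eq_left h, mul_one]
    -- Beyond `u = 1` monotonicity suffices; on `[0, 1]` the convex `exp (-u)` lies below its chord.
    have := Real.exp_le_exp.2 (neg_le_neg h)
    linarith
  · rw [min_eq_right h]
    have := convexOn_exp.2 (Set.mem_univ (-1)) (Set.mem_univ 0) hu (sub_nonneg.2 h) (by ring)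
    simp only [smul_eq_mul, mul_zero, add_zero, Real.exp_zero, mul_neg, mul_one] at this
    linarith

open MeasureTheory in
theorem exists_exponential_embedding {M : ℝ} (hM : 0 < M) :
    ∃ T : L1 → L1, (∀ x, ‖T x‖ = M) ∧ ∀ x y,
      ‖T x - T y‖ = M * (1 - Real.exp (-(‖x - y‖ / M))) := by
  obtain ⟨T₀, hnorm, hdist⟩ := exists_exponential_embedding_continuous hM
  have hint (f : C(unitInterval, ℝ)) : Integrable (fun t => f t) :=
    Integrable.of_bound f.continuous.aestronglyMeasurable ‖f‖
      (ae_of_all _ fun t => f.norm_coe_le_norm t)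
  set s : Set L1 := Set.range fun f : C(unitInterval, ℝ) => (hint f).toL1 _ with hs_def
  have hs : Dense s := by
    have h := ContinuousMap.toLp_denseRange (p := 1) ℝ (volume : Measure unitInterval) ℝ
      ENNReal.one_ne_top
    refine h.mono ?_
    rintro _ ⟨f, rfl⟩
    exact ⟨f, rfl⟩
  choose rep hrep using fun x : s => x.2
  have hdist' (x y : s) : ‖T₀ (rep x) - T₀ (rep y)‖ =
      M * (1 - Real.exp (-(‖(x : L1) - y‖ / M))) := by
    rw [hdist, ← hrep x, ← hrep y, norm_toL1_sub_toL1]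
  -- `1 - exp (-u) ≤ u` makes the map uniformly continuous on the dense set; both required
  -- identities are closed conditions, so they pass to the extension.
  have hlip : LipschitzWith 1 fun x : s => T₀ (rep x) := by
    refine LipschitzWith.of_dist_le_mul fun x y => ?_
    rw [dist_eq_norm, hdist', NNReal.coe_one, one_mul, Subtype.dist_eq, dist_eq_norm]
    have h := (one_sub_exp_neg_le_min (‖(x : L1) - y‖ / M)).trans (min_le_right _ _)
    calc M * (1 - Real.exp (-(‖(x : L1) - y‖ / M))) ≤ M * (‖(x : L1) - y‖ / M) := by gcongr
      _ = ‖(x : L1) - y‖ := by field_simp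
  have hT := hlip.uniformContinuous
  have hcont : Continuous (hs.extend fun x : s => T₀ (rep x)) :=
    (hs.uniformContinuous_extend hT).continuous
  refine ⟨hs.extend fun x => T₀ (rep x), fun x => ?_, fun x y => ?_⟩
  · refine hs.induction (P := fun x => ‖hs.extend (fun x : s => T₀ (rep x)) x‖ = M)
      (fun x hx => ?_) (isClosed_eq hcont.norm continuous_const) x
    rw [hs.extend_of_ind hT ⟨x, hx⟩, hnorm]
  · have hclosed : IsClosed {p : L1 × L1 | ‖hs.extend (fun x : s => T₀ (rep x)) p.1 -
        hs.extend (fun x : s => T₀ (rep x)) p.2‖ = M * (1 - Real.exp (-(‖p.1 - p.2‖ / M)))} :=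
      isClosed_eq (by fun_prop) (by fun_prop)
    refine isClosed_property2 (e := ((↑) : s → L1)) (p := fun x y =>
      ‖hs.extend (fun x : s => T₀ (rep x)) x -
        hs.extend (fun x : s => T₀ (rep x)) y‖ = M * (1 - Real.exp (-(‖x - y‖ / M))))
      hs.denseRange_val hclosed (fun x y => ?_) x y
    rw [hs.extend_of_ind hT, hs.extend_of_ind hT, hdist']

theorem exists_isTruncatedEmbedding {M : ℝ} (hM : 0 < M) :
    ∃ T : L1 → L1, IsTruncatedEmbedding M T := by
  obtain ⟨T, hnorm, hdist⟩ := exists_exponential_embedding hM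
  refine ⟨T, hnorm, fun x y => ?_⟩
  have hu : 0 ≤ ‖x - y‖ / M := by positivity
  have hmin : min M ‖x - y‖ = M * min 1 (‖x - y‖ / M) := by
    rw [mul_min_of_nonneg _ _ hM.le, mul_one, mul_div_cancel₀ _ hM.ne']
  rw [hdist, hmin, mul_left_comm]
  exact ⟨mul_le_mul_of_nonneg_left (mul_min_le_one_sub_exp_neg _ hu) hM.le,
    mul_le_mul_of_nonneg_left (one_sub_exp_neg_le_min _) hM.le⟩

/-! ### Estimates for the cone distance -/

theorem planarDist_sq (s t θ : ℝ) :
    planarDist s t θ ^ 2 = (s - t) ^ 2 + 4 * s * t * Real.sin (θ / 2) ^ 2 := by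
  have hcos : Real.cos θ = 1 - 2 * Real.sin (θ / 2) ^ 2 := by
    rw [← mul_div_cancel₀ θ (two_ne_zero' ℝ), Real.cos_two_mul, Real.cos_sq']
    ring_nf
  rw [planarDist, Real.sq_sqrt, hcos]
  · ring
  · nlinarith [sq_nonneg (s - t * Real.cos θ), mul_nonneg (sq_nonneg t) (sq_nonneg (Real.sin θ)),
      Real.sin_sq_add_cos_sq θ]

theorem planarDist_nonneg (s t θ : ℝ) : 0 ≤ planarDist s t θ := Real.sqrt_nonneg _

/-- Monotonicity of `sin θ / θ`. -/
theorem sin_mul_le_mul_sin {c θ : ℝ} (hc : 1 ≤ c) (hθ : 0 ≤ θ) (hcθ : c * θ ≤ Real.pi) :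
    Real.sin (c * θ) ≤ c * Real.sin θ := by
  have hc0 : 0 < c := by linarith
  have hx : c * θ ∈ Set.Icc 0 Real.pi := ⟨by positivity, hcθ⟩
  have h := strictConcaveOn_sin_Icc.concaveOn.2 hx ⟨le_rfl, Real.pi_pos.le⟩
    (inv_pos.2 hc0).le (sub_nonneg.2 (inv_le_one_of_one_le₀ hc)) (by ring)
  simp only [smul_eq_mul, mul_zero, add_zero, Real.sin_zero] at h
  rw [inv_mul_cancel_left₀ hc0.ne', inv_mul_le_iff₀ hc0] at h
  exact h

theorem planarDist_mul_le {s t c θ : ℝ} (hs : 0 ≤ s) (ht : 0 ≤ t) (hc : 1 ≤ c) (hθ : 0 ≤ θ)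
    (hcθ : c * θ ≤ Real.pi) : planarDist s t (c * θ) ≤ c * planarDist s t θ := by
  have hc0 : 0 < c := by linarith
  refine le_of_sq_le_sq ?_ (mul_nonneg hc0.le (planarDist_nonneg _ _ _))
  rw [mul_pow, planarDist_sq, planarDist_sq]
  have hsin := sin_mul_le_mul_sin hc (by positivity : 0 ≤ θ / 2)
    (by linarith [Real.pi_pos])
  rw [← mul_div_assoc] at hsin
  have h0 : 0 ≤ Real.sin (c * θ / 2) :=
    Real.sin_nonneg_of_nonneg_of_le_pi (by positivity) (by linarith [Real.pi_pos])
  have h1 := pow_le_pow_left₀ h0 hsin 2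
  have hst : 0 ≤ 4 * s * t := by positivity
  have h2 := mul_le_mul_of_nonneg_left h1 hst
  have h3 : (s - t) ^ 2 ≤ c ^ 2 * (s - t) ^ 2 :=
    le_mul_of_one_le_left (sq_nonneg _) (one_le_pow₀ hc)
  linarith

theorem min_pi_mul_le {c d : ℝ} (hc : 1 ≤ c) :
    min Real.pi (c * d) ≤ c * min Real.pi d := by
  rw [mul_min_of_nonneg _ _ (by linarith)]
  exact min_le_min_right _ (le_mul_of_one_le_left Real.pi_pos.le hc)

theorem planarDist_min_pi_mul_le {s t c d : ℝ} (hs : 0 ≤ s) (ht : 0 ≤ t) (hc : 1 ≤ c)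
    (hd : 0 ≤ d) :
    planarDist s t (min Real.pi (c * d)) ≤ c * planarDist s t (min Real.pi d) := by
  have hpi := Real.pi_pos
  set θ := min Real.pi d with hθ
  have hθ0 : 0 ≤ θ := le_min hpi.le hd
  rcases hθ0.eq_or_lt with h0 | h0
  · have hd0 : d = 0 := by
      rcases min_choice Real.pi d with h | h <;> rw [← hθ] at h <;> linarith
    rw [hd0, mul_zero, min_eq_right hpi.le, ← h0]
    exact le_mul_of_one_le_left (planarDist_nonneg _ _ _) hc
  · have hle : min Real.pi (c * d) ≤ c * θ := min_pi_mul_le hc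
    have hge : θ ≤ min Real.pi (c * d) :=
      min_le_min_left _ (le_mul_of_one_le_left hd hc)
    -- `c * θ` may exceed `π`, so the angle is scaled by the effective factor `c' ∈ [1, c]` instead.
    set c' := min Real.pi (c * d) / θ with hc'
    have heq : min Real.pi (c * d) = c' * θ := by rw [hc', div_mul_cancel₀ _ h0.ne']
    have h1 : 1 ≤ c' := by rw [hc', one_le_div h0]; exact hge
    have h2 : c' ≤ c := by rw [hc', div_le_iff₀ h0]; exact hle
    rw [heq]
    refine (planarDist_mul_le hs ht h1 h0.le (heq ▸ min_le_left _ _)).trans ?_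
    exact mul_le_mul_of_nonneg_right h2 (planarDist_nonneg _ _ _)

section ConeEstimates

variable {E : Type*} [NormedAddCommGroup E] [NormedSpace ℝ E]

/-- The upper estimate for radial extensions of maps into a sphere of radius `π`. -/
theorem norm_smul_sub_smul_le {s t θ : ℝ} {u v : E} (hs : 0 < s) (ht : 0 < t) (hθ : 0 ≤ θ)
    (hθpi : θ ≤ Real.pi) (hu : ‖u‖ = Real.pi) (hv : ‖v‖ = Real.pi) (huv : ‖u - v‖ ≤ θ) :
    ‖s • u - t • v‖ ≤ Real.pi * Real.sqrt 5 / 2 * planarDist s t θ := by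
  have hpi := Real.pi_pos
  have hmain : ‖s • u - t • v‖ ≤ Real.pi * |s - t| + Real.sqrt (s * t) * θ := by
    have key {a b : ℝ} {x y : E} (ha : 0 < a) (hab : a ≤ b) (hy : ‖y‖ = Real.pi)
        (hxy : ‖x - y‖ ≤ θ) : ‖a • x - b • y‖ ≤ Real.pi * |a - b| + Real.sqrt (a * b) * θ := by
      -- The smaller radius multiplies the angular term, and `a ≤ √(a b)`.
      have h : a • x - b • y = (a - b) • y + a • (x - y) := by module
      rw [h]
      refine (norm_add_le _ _).trans (add_le_add ?_ ?_)
      · rw [norm_smul, hy, Real.norm_eq_abs, mul_comm]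
      · rw [norm_smul, Real.norm_eq_abs, abs_of_pos ha]
        exact mul_le_mul (Real.le_sqrt_of_sq_le (by nlinarith)) hxy (norm_nonneg _)
          (Real.sqrt_nonneg _)
    rcases le_total s t with h | h
    · exact key hs h hv huv
    · rw [norm_sub_rev, abs_sub_comm, mul_comm s t]
      exact key ht h hu (by rwa [norm_sub_rev])
  refine hmain.trans (le_of_sq_le_sq ?_ (mul_nonneg (by positivity) (planarDist_nonneg _ _ _)))
  -- Jordan's inequality, which bounds the angular part of the cone distance from below.
  have hsin : θ / Real.pi ≤ Real.sin (θ / 2) := by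
    have := Real.mul_le_sin (by positivity : 0 ≤ θ / 2) (by linarith)
    convert this using 1
    field_simp
  have hsin2 : θ ^ 2 ≤ Real.pi ^ 2 * Real.sin (θ / 2) ^ 2 := by
    rw [← mul_pow]
    exact pow_le_pow_left₀ hθ (by rwa [div_le_iff₀' hpi] at hsin) 2
  rw [mul_pow, planarDist_sq, div_pow, mul_pow, Real.sq_sqrt (by norm_num)]
  have hst : 0 < s * t := mul_pos hs ht
  set a := |s - t| with ha
  have ha2 : (s - t) ^ 2 = a ^ 2 := (sq_abs _).symm
  set b := Real.sqrt (s * t) with hb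
  have hb2 : b ^ 2 = s * t := Real.sq_sqrt hst.le
  have h1 : b ^ 2 * θ ^ 2 ≤ s * t * (Real.pi ^ 2 * Real.sin (θ / 2) ^ 2) := by
    rw [hb2]
    exact mul_le_mul_of_nonneg_left hsin2 hst.le
  rw [ha2]
  -- Cauchy–Schwarz with weights `1` and `1/2`: `(π a + b θ)² ≤ (1 + 1/4) (π² a² + 4 b² θ²)`, the
  -- origin of `√5 / 2`.
  nlinarith [sq_nonneg (Real.pi * a - 4 * (b * θ))]

/-- The lower estimate for radial extensions of maps into a sphere of radius `π`. -/
theorem planarDist_sq_le_norm_smul_sub_smul {s t θ c : ℝ} {u v : E} (hs : 0 < s) (ht : 0 < t)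
    (hθ : 0 ≤ θ) (hθpi : θ ≤ Real.pi) (hc : 0 < c) (hu : ‖u‖ = Real.pi) (hv : ‖v‖ = Real.pi)
    (huv : c * θ ≤ ‖u - v‖) :
    planarDist s t θ ^ 2 ≤ (1 / Real.pi ^ 2 + 4 / c ^ 2) * ‖s • u - t • v‖ ^ 2 := by
  have hpi := Real.pi_pos
  set A := ‖s • u - t • v‖ with hA
  have hA0 : 0 ≤ A := norm_nonneg _
  have hrad : Real.pi * |s - t| ≤ A := by
    have h := abs_norm_sub_norm_le (s • u) (t • v)
    rwa [norm_smul, norm_smul, hu, hv, Real.norm_eq_abs, Real.norm_eq_abs, abs_of_pos hs,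
      abs_of_pos ht, ← sub_mul, abs_mul, abs_of_pos hpi, mul_comm] at h
  -- Equalising the radii costs `π |s - t| ≤ A`. Doing it at `s` and at `t` and multiplying gives
  -- the factor `s t` of the angular term.
  have hs2 : s * (c * θ) ≤ 2 * A := by
    have h : s • (u - v) = (s • u - t • v) + (t - s) • v := by module
    have h' := norm_add_le (s • u - t • v) ((t - s) • v)
    rw [← h, norm_smul, norm_smul, hv, Real.norm_eq_abs, Real.norm_eq_abs, abs_of_pos hs,
      abs_sub_comm] at h'
    have := mul_le_mul_of_nonneg_left huv hs.le
    linarith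
  have ht2 : t * (c * θ) ≤ 2 * A := by
    have h : t • (u - v) = (s • u - t • v) + (t - s) • u := by module
    have h' := norm_add_le (s • u - t • v) ((t - s) • u)
    rw [← h, norm_smul, norm_smul, hu, Real.norm_eq_abs, Real.norm_eq_abs, abs_of_pos ht,
      abs_sub_comm] at h'
    have := mul_le_mul_of_nonneg_left huv ht.le
    linarith
  have hprod : s * t * θ ^ 2 ≤ 4 / c ^ 2 * A ^ 2 := by
    have := mul_le_mul hs2 ht2 (by positivity) (by positivity)
    rw [div_mul_eq_mul_div, le_div_iff₀ (by positivity)]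
    linarith
  have hdiff : (s - t) ^ 2 ≤ 1 / Real.pi ^ 2 * A ^ 2 := by
    rw [div_mul_eq_mul_div, le_div_iff₀ (by positivity), one_mul, ← sq_abs (s - t), ← mul_pow,
      mul_comm]
    exact pow_le_pow_left₀ (by positivity) hrad 2
  have hsin : Real.sin (θ / 2) ^ 2 ≤ (θ / 2) ^ 2 :=
    pow_le_pow_left₀ (Real.sin_nonneg_of_nonneg_of_le_pi (by positivity) (by linarith))
      (Real.sin_le (by positivity)) 2
  rw [planarDist_sq, add_mul]
  have := mul_le_mul_of_nonneg_left hsin (by positivity : 0 ≤ 4 * s * t)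
  linarith

end ConeEstimates

theorem sqrt_lower_constant {x y p : ℝ} (hx : 0 < x) (hp : 0 < p) (hy : 0 < y) :
    (p * y / Real.sqrt (4 * p ^ 2 * x ^ 2 + y ^ 2)) ^ 2 * (1 / p ^ 2 + 4 / (y / x) ^ 2) = 1 := by
  rw [div_pow, Real.sq_sqrt (by positivity)]
  field_simp
  ring

/-- The upper bound gives uniform continuity, hence an extension to the completion; both bounds are
closed conditions. -/
theorem exists_lipschitz_extension_cone {X E : Type*} [MetricSpace X] [MetricSpace E]
    [CompleteSpace E] {a b : ℝ} (f : OpenCone X → E)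
    (hlow : ∀ p q, a * dist p q ≤ dist (f p) (f q))
    (hup : ∀ p q, dist (f p) (f q) ≤ b * dist p q) :
    ∃ F : EuclideanCone X → E, (∀ p : OpenCone X, F p = f p) ∧
      ∀ p q, a * dist p q ≤ dist (F p) (F q) ∧ dist (F p) (F q) ≤ b * dist p q := by
  have hf : UniformContinuous f := by
    refine (LipschitzWith.of_dist_le_mul (K := b.toNNReal) fun p q => ?_).uniformContinuous
    exact (hup p q).trans (mul_le_mul_of_nonneg_right (Real.le_coe_toNNReal b) dist_nonneg)
  have hc : Continuous (UniformSpace.Completion.extension f) :=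
    UniformSpace.Completion.continuous_extension
  refine ⟨UniformSpace.Completion.extension f,
    fun p => UniformSpace.Completion.extension_coe hf p, fun p q => ?_⟩
  refine UniformSpace.Completion.induction_on₂ p q ?_ fun p q => ?_
  · rw [Set.ofPred_and]
    exact (isClosed_le (by fun_prop) (by fun_prop)).inter
      (isClosed_le (by fun_prop) (by fun_prop))
  · rw [UniformSpace.Completion.extension_coe hf, UniformSpace.Completion.extension_coe hf,
      UniformSpace.Completion.dist_eq]
    exact ⟨hlow p q, hup p q⟩

theorem exists_cone_embedding {T : L1 → L1} (hT : IsTruncatedEmbedding Real.pi T) :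
    ∃ F : EuclideanCone L1 → L1,
      (∀ (s : ℝ) (hs : 0 < s) (x : L1), F (EuclideanCone.mk s hs x) = s • T x) ∧
      ∀ p q : EuclideanCone L1,
        Real.pi * (Real.exp 1 - 1) /
            Real.sqrt (4 * Real.pi ^ 2 * Real.exp 1 ^ 2 + (Real.exp 1 - 1) ^ 2) * dist p q
          ≤ ‖F p - F q‖ ∧
        ‖F p - F q‖ ≤ Real.pi * Real.sqrt 5 / 2 * dist p q := by
  obtain ⟨hnorm, hdist⟩ := hT
  have hpi := Real.pi_pos
  have he : 0 < Real.exp 1 - 1 := by linarith [Real.exp_one_gt_d9]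
  have hθ (x y : L1) : 0 ≤ min Real.pi (dist x y) := le_min hpi.le dist_nonneg
  obtain ⟨F, hF, hF'⟩ := exists_lipschitz_extension_cone
    (a := Real.pi * (Real.exp 1 - 1) /
      Real.sqrt (4 * Real.pi ^ 2 * Real.exp 1 ^ 2 + (Real.exp 1 - 1) ^ 2))
    (b := Real.pi * Real.sqrt 5 / 2) (fun p : OpenCone L1 => p.radius • T p.base)
    (fun p q => by
      have h := (hdist p.base q.base).1
      rw [← dist_eq_norm p.base, one_sub_div (Real.exp_pos 1).ne'] at h
      have h' := planarDist_sq_le_norm_smul_sub_smul p.radius_pos q.radius_pos (hθ _ _)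
        (min_le_left _ _) (div_pos he (Real.exp_pos 1)) (hnorm _) (hnorm _) h
      rw [dist_eq_norm (p.radius • T p.base)]
      refine le_of_sq_le_sq ?_ (norm_nonneg _)
      rw [mul_pow]
      refine (mul_le_mul_of_nonneg_left h' (sq_nonneg _)).trans ?_
      rw [← mul_assoc, sqrt_lower_constant (Real.exp_pos 1) hpi he, one_mul])
    (fun p q => by
      have h := (hdist p.base q.base).2
      rw [← dist_eq_norm p.base] at h
      rw [dist_eq_norm (p.radius • T p.base)]
      exact norm_smul_sub_smul_le p.radius_pos q.radius_pos (hθ _ _) (min_le_left _ _)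
        (hnorm _) (hnorm _) h)
  refine ⟨F, fun s hs x => hF _, fun p q => ?_⟩
  rw [← dist_eq_norm]
  exact hF' p q

/-! ### The distortion constant -/

theorem upper_constant_eq_coneDistortion_mul_lower_constant :
    Real.pi * Real.sqrt 5 / 2 = coneDistortion * (Real.pi * (Real.exp 1 - 1) /
      Real.sqrt (4 * Real.pi ^ 2 * Real.exp 1 ^ 2 + (Real.exp 1 - 1) ^ 2)) := by
  have he : 0 < Real.exp 1 - 1 := by linarith [Real.exp_one_gt_d9]
  have hpi := Real.pi_pos
  have hsplit : 20 * Real.pi ^ 2 * Real.exp 1 ^ 2 + 5 * (Real.exp 1 - 1) ^ 2 =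
      5 * (4 * Real.pi ^ 2 * Real.exp 1 ^ 2 + (Real.exp 1 - 1) ^ 2) := by ring
  have hpos : 0 < Real.sqrt (4 * Real.pi ^ 2 * Real.exp 1 ^ 2 + (Real.exp 1 - 1) ^ 2) :=
    Real.sqrt_pos.2 (by positivity)
  rw [coneDistortion, hsplit, Real.sqrt_mul (by norm_num)]
  field_simp

theorem one_le_coneDistortion : 1 ≤ coneDistortion := by
  have he : 0 < Real.exp 1 - 1 := by linarith [Real.exp_one_gt_d9]
  rw [coneDistortion, one_le_div (by positivity)]
  refine Real.le_sqrt_of_sq_le ?_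
  have : 0 ≤ 20 * Real.pi ^ 2 * Real.exp 1 ^ 2 := by positivity
  nlinarith [sq_nonneg (Real.exp 1 - 1)]

theorem coneDistortion_le : coneDistortion ≤ 11.17 := by
  have he := Real.exp_one_gt_d9
  have he0 : 0 < Real.exp 1 - 1 := by linarith
  have hpi := Real.pi_lt_d6
  have hpi0 := Real.pi_pos
  rw [coneDistortion, div_le_iff₀ (by linarith)]
  refine Real.sqrt_le_iff.2 ⟨by linarith, ?_⟩
  -- The window is narrow: `π e / (e - 1) ≈ 4.9699`, while `11.17` allows at most about `4.9702`.
  have h1 : Real.pi * Real.exp 1 ≤ 4.97 * (Real.exp 1 - 1) := by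
    have : Real.pi * Real.exp 1 ≤ 3.141593 * Real.exp 1 := by gcongr
    linarith
  have h2 := pow_le_pow_left₀ (by positivity) h1 2
  rw [mul_pow, mul_pow] at h2
  nlinarith [sq_nonneg (Real.exp 1 - 1)]

/-! ### Cones over general metric spaces -/

/-- Coning a bi-Lipschitz map does not increase its distortion. -/
theorem AdmitsBiLipEmbedding.coneComp {X : Type*} [MetricSpace X] {D K : ℝ}
    (hX : AdmitsBiLipEmbedding X L1 D) (hK : AdmitsBiLipEmbedding (EuclideanCone L1) L1 K) :
    AdmitsBiLipEmbedding (EuclideanCone X) L1 (K * D) := by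
  obtain ⟨hD, σ, hσ, f, hf⟩ := hX
  obtain ⟨hK1, τ, hτ, G, hG⟩ := hK
  -- Truncation at `π` is not scale invariant, so the map is first normalised to have lower constant
  -- `1`.
  let g : X → L1 := fun x => σ⁻¹ • f x
  have hgd (x y : X) : dist (g x) (g y) = σ⁻¹ * dist (f x) (f y) := by
    rw [dist_smul₀, Real.norm_eq_abs, abs_of_pos (inv_pos.2 hσ)]
  have hg1 (x y : X) : dist x y ≤ dist (g x) (g y) := by
    rw [hgd, ← div_eq_inv_mul, le_div_iff₀' hσ]
    exact (hf x y).1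
  have hg2 (x y : X) : dist (g x) (g y) ≤ D * dist x y := by
    rw [hgd, ← div_eq_inv_mul, div_le_iff₀' hσ]
    exact (hf x y).2.trans_eq (by ring)
  have hpi := Real.pi_pos
  let H : OpenCone X → EuclideanCone L1 := fun p =>
    EuclideanCone.mk p.radius p.radius_pos (g p.base)
  have hH (p q : OpenCone X) : dist (H p) (H q) =
      planarDist p.radius q.radius (min Real.pi (dist (g p.base) (g q.base))) :=
    UniformSpace.Completion.dist_eq _ _
  have hH1 (p q : OpenCone X) : dist p q ≤ dist (H p) (H q) := by
    rw [hH]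
    exact planarDist_mono p.radius_pos.le q.radius_pos.le (le_min hpi.le dist_nonneg)
      (min_le_min_left _ (hg1 _ _)) (min_le_left _ _)
  have hH2 (p q : OpenCone X) : dist (H p) (H q) ≤ D * dist p q := by
    rw [hH]
    refine (planarDist_mono p.radius_pos.le q.radius_pos.le (le_min hpi.le dist_nonneg)
      (min_le_min_left _ (hg2 _ _)) (min_le_left _ _)).trans ?_
    exact planarDist_min_pi_mul_le p.radius_pos.le q.radius_pos.le hD dist_nonneg
  obtain ⟨F, -, hF⟩ := exists_lipschitz_extension_cone (a := τ) (b := K * D * τ)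
    (fun p => G (H p))
    (fun p q => (mul_le_mul_of_nonneg_left (hH1 p q) hτ.le).trans (hG _ _).1)
    (fun p q => (hG _ _).2.trans
      ((mul_le_mul_of_nonneg_left (hH2 p q) (by positivity)).trans_eq (by ring)))
  exact ⟨one_le_mul_of_one_le_of_one_le hK1 hD, τ, hτ, F, hF⟩

theorem c₁_le_of_admitsBiLipEmbedding {U : Type*} [MetricSpace U] {D : ℝ}
    (h : AdmitsBiLipEmbedding U L1 D) : c₁ U ≤ ENNReal.ofReal D :=
  iInf₂_le D h

theorem c₁_euclideanCone_le {K : ℝ} (hK : AdmitsBiLipEmbedding (EuclideanCone L1) L1 K)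
    (X : Type*) [MetricSpace X] : c₁ (EuclideanCone X) ≤ ENNReal.ofReal K * c₁ X := by
  have hK0 : 0 < K := zero_lt_one.trans_le hK.1
  -- A nonzero finite factor moves inside the infimum, even when the infimum is `∞`.
  have hne : ENNReal.ofReal K ≠ 0 := by simpa using hK0
  simp only [c₁, ENNReal.mul_iInf_of_ne hne ENNReal.ofReal_ne_top]
  refine le_iInf₂ fun D hD => ?_
  rw [← ENNReal.ofReal_mul hK0.le]
  exact c₁_le_of_admitsBiLipEmbedding (hD.coneComp hK)

theorem admitsBiLipEmbedding_euclideanCone_L1 :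
    AdmitsBiLipEmbedding (EuclideanCone L1) L1 coneDistortion := by
  obtain ⟨T, hT⟩ := exists_isTruncatedEmbedding Real.pi_pos
  obtain ⟨F, -, hF⟩ := exists_cone_embedding hT
  have he : 0 < Real.exp 1 - 1 := by linarith [Real.exp_one_gt_d9]
  have hpi := Real.pi_pos
  refine ⟨one_le_coneDistortion, Real.pi * (Real.exp 1 - 1) /
    Real.sqrt (4 * Real.pi ^ 2 * Real.exp 1 ^ 2 + (Real.exp 1 - 1) ^ 2),
    div_pos (by positivity) (Real.sqrt_pos.2 (by positivity)), F, fun p q => ?_⟩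
  rw [← upper_constant_eq_coneDistortion_mul_lower_constant, dist_eq_norm (F p)]
  exact hF p q

theorem proposition3p5 :
    (∃ T : L1 → L1, IsTruncatedEmbedding Real.pi T) ∧
    (∀ T : L1 → L1, IsTruncatedEmbedding Real.pi T →
      ∃ F : EuclideanCone L1 → L1,
        (∀ (s : ℝ) (hs : 0 < s) (x : L1), F (EuclideanCone.mk s hs x) = s • T x) ∧
        ∀ p q : EuclideanCone L1,
          Real.pi * (Real.exp 1 - 1) /
              Real.sqrt (4 * Real.pi ^ 2 * Real.exp 1 ^ 2 + (Real.exp 1 - 1) ^ 2) * dist p q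
            ≤ ‖F p - F q‖ ∧
          ‖F p - F q‖ ≤ Real.pi * Real.sqrt 5 / 2 * dist p q) ∧
    AdmitsBiLipEmbedding (EuclideanCone L1) L1 coneDistortion ∧
    c₁ (EuclideanCone L1) ≤ ENNReal.ofReal coneDistortion ∧
    coneDistortion ≤ 11.17 ∧
    (∀ (X : Type*) [MetricSpace X],
      c₁ (EuclideanCone X) ≤ ENNReal.ofReal coneDistortion * c₁ X) := by
  exact ⟨exists_isTruncatedEmbedding Real.pi_pos, fun _ hT => exists_cone_embedding hT,
    admitsBiLipEmbedding_euclideanCone_L1,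
    c₁_le_of_admitsBiLipEmbedding admitsBiLipEmbedding_euclideanCone_L1, coneDistortion_le,
    fun X _ => c₁_euclideanCone_le admitsBiLipEmbedding_euclideanCone_L1 X⟩
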